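/- Let $E=\{z\in\mathbb C:|z|<1\}$. Let $S_H$ be the class of univalent harmonic mappings $f=h+\overline g$ of $E$ ($h,g$ analytic in $E$, $g(0)=0$) that are sense-preserving, i.e. $|h'|^2-|g'|^2>0$ in $E$, and normalized by $h(0)=0$, $h'(0)=1$. For $F=H+\overline G$ and $f=h+\overline g$ with $H=\sum A_nz^n$, $G=\sum B_nz^n$, $h=\sum a_nz^n$, $g=\sum b_nz^n$ analytic in $E$ and vanishing at $0$, let $F\ast f=\sum_{n\ge1} A_na_nz^n+\overline{\sum_{n\ge1} B_nb_nz^n}$. A mapping of $E$ is convex in the horizontal direction if its image is a domain that meets every horizontal line in a connected (possibly empty) set. For real $a$ with $|a|<1$ let $f_a=h_a+\overline{g_a}$, where $$h_a(z)=\frac{\frac1{1+a}z-\frac12z^2}{(1-z)^2},\qquad g_a(z)=\frac{\frac a{1+a}z-\frac12z^2}{(1-z)^2}.$$ **Theorem 2.3.** Let $a,b$ be real, $|a|<1$, $|b|<1$, and let $f_b=h+\overline g$, with $h,g$ analytic in $E$ and $h(0)=0$, be the right half-plane mapping given by $h(z)+g(z)=\frac{z}{1-z}$ with dilatation $\frac{g'(z)}{h'(z)}=\frac{b-z}{1-bz}$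 (where $h'\neq0$ in $E$). If $b\ge-\frac{1+3a}{3+a}$, then $f_a\ast f_b$ is harmonic, univalent and sense-preserving in $E$ and convex in the horizontal direction, and, after normalization, $(1+a)(1+b)\,(f_a\ast f_b)\in S_H$. -/

import Mathlib

noncomputable section

namespace HarmonicConv

/-- The open unit disk `E`. -/
def unitDisk : Set ℂ := Metric.ball (0 : ℂ) 1

/-- The `n`-th Taylor coefficient at the origin. -/
def taylorCoeff (F : ℂ → ℂ) (n : ℕ) : ℂ := iteratedDeriv n F 0 / (n.factorial : ℂ)

/-- The Hadamard product `∑ Aₙ Bₙ zⁿ` of two functions `∑ Aₙ zⁿ` and `∑ Bₙ zⁿ` analytic in the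
unit disk (for such functions the series converges at every point of the disk). -/
def hadamard (F G : ℂ → ℂ) (z : ℂ) : ℂ := ∑' n : ℕ, taylorCoeff F n * taylorCoeff G n * z ^ n

/-- The harmonic mapping `h + conj g` with analytic part `h` and co-analytic part `g`. -/
def harmonicMap (h g : ℂ → ℂ) (z : ℂ) : ℂ := h z + starRingEnd ℂ (g z)

/-- The convolution of the harmonic mappings `H + conj G` and `h + conj g`. -/
def convolution (H G h g : ℂ → ℂ) : ℂ → ℂ := harmonicMap (hadamard H h) (hadamard G g)

/-- `h + conj g` has dilatation `ω = g' / h'` in the unit disk. -/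
def HasDilatation (h g ω : ℂ → ℂ) : Prop :=
  ∀ z ∈ unitDisk, deriv h z ≠ 0 ∧ deriv g z / deriv h z = ω z

/-- The class `S_H`: harmonic, sense-preserving (positive Jacobian `|h'|² - |g'|²`), univalent
mappings `f = h + conj g` of the unit disk, normalized by `h 0 = 0` and `h' 0 = 1`
(and `g 0 = 0`, as in the series representation of `f`). -/
def InSH (f : ℂ → ℂ) : Prop :=
  ∃ h g : ℂ → ℂ,
    DifferentiableOn ℂ h unitDisk ∧ DifferentiableOn ℂ g unitDisk ∧
    h 0 = 0 ∧ g 0 = 0 ∧ deriv h 0 = 1 ∧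
    (∀ z ∈ unitDisk, f z = harmonicMap h g z) ∧
    (∀ z ∈ unitDisk, 0 < ‖deriv h z‖ ^ 2 - ‖deriv g z‖ ^ 2) ∧
    Set.InjOn f unitDisk

/-- The line through `w` parallel to the line joining `0` and `e^{iφ}`. -/
def lineInDirection (φ : ℝ) (w : ℂ) : Set ℂ :=
  Set.range fun t : ℝ => w + (t : ℂ) * Complex.exp ((φ : ℂ) * Complex.I)

/-- `Ω` is a domain that is convex in the direction `φ`: every line parallel to the line joining
`0` and `e^{iφ}` has a connected (possibly empty) intersection with `Ω`. -/
def ConvexInDirection (φ : ℝ) (Ω : Set ℂ) : Prop :=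
  IsOpen Ω ∧ IsConnected Ω ∧ ∀ w : ℂ, IsPreconnected (Ω ∩ lineInDirection φ w)

/-- A mapping of the unit disk is convex in the horizontal direction if its image is. -/
def IsCHD (f : ℂ → ℂ) : Prop := ConvexInDirection 0 (f '' unitDisk)

/-- The analytic part of the right half-plane mapping `f_a`. -/
def hA (a : ℝ) (z : ℂ) : ℂ := (1 / (1 + (a : ℂ)) * z - 1 / 2 * z ^ 2) / (1 - z) ^ 2

/-- The co-analytic part of the right half-plane mapping `f_a`. -/
def gA (a : ℝ) (z : ℂ) : ℂ := ((a : ℂ) / (1 + (a : ℂ)) * z - 1 / 2 * z ^ 2) / (1 - z) ^ 2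

end HarmonicConv

end

namespace HarmonicConv

/-! The convolution is a horizontal shear of a Koebe function. With k the Koebe function and c =
(1-a)/(1+a), the parts of f_a are (±c k + z/(1-z))/2, so f_a * f_b = H + conj G with H = (h + c z
h')/2 and G = (g - c z g')/2. Since z(h' + g') = k and h - g = ((1-b)/(1+b)) k, the difference H - G
is a positive multiple C k (`hadamard_eq`, `halfPlane_sub`).

The Jacobian is positive because G'/H' is a quotient of a real quadratic and its reversal. The
difference of squared moduli factors explicitly, and the hypothesis on b is what makes the last
factor positive (`norm_numerator_lt`).

Univalence and horizontal convexity then follow as in Clunie and Sheil-Small. The image of k is the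
plane slit along (-∞, -1/4], whose horizontal slices are intervals. In the coordinate w = k(z) the
map has imaginary part C Im w, and its real part is strictly increasing on each slice
(`hasDerivAt_shear_slice`). -/

/-- The Koebe function. -/
noncomputable def koebe (z : ℂ) : ℂ := z / (1 - z) ^ 2

/-- The principal square root on the slit plane. -/
noncomputable def slitSqrt (w : ℂ) : ℂ := Complex.exp (Complex.log w / 2)

/-- The inverse of the Koebe function on its image. -/
noncomputable def koebeInv (w : ℂ) : ℂ :=
  (slitSqrt (1 + 4 * w) - 1) / (slitSqrt (1 + 4 * w) + 1)

/-! ### The Koebe function and its inverse on the slit plane. -/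

lemma mem_unitDisk {z : ℂ} : z ∈ unitDisk ↔ ‖z‖ < 1 := by
  simp [unitDisk]

lemma isOpen_unitDisk : IsOpen unitDisk := Metric.isOpen_ball

lemma one_sub_ne_zero {z : ℂ} (hz : z ∈ unitDisk) : 1 - z ≠ 0 := by
  intro h
  rw [mem_unitDisk, ← sub_eq_zero.1 h] at hz
  simp at hz

lemma slitSqrt_sq {w : ℂ} (hw : w ≠ 0) : slitSqrt w ^ 2 = w := by
  rw [slitSqrt, ← Complex.exp_nat_mul]
  push_cast
  rw [mul_div_cancel₀ _ (two_ne_zero), Complex.exp_log hw]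

lemma slitSqrt_re_pos {w : ℂ} (hw : w ∈ Complex.slitPlane) : 0 < (slitSqrt w).re := by
  rw [slitSqrt, Complex.exp_re]
  refine mul_pos (Real.exp_pos _) (Real.cos_pos_of_mem_Ioo ?_)
  have him : (Complex.log w / 2).im = w.arg / 2 := by
    rw [← Complex.log_im]; simp
  rw [him]
  have h1 := Complex.neg_pi_lt_arg w
  have h2 := lt_of_le_of_ne (Complex.arg_le_pi w) (Complex.mem_slitPlane_iff_arg.1 hw).1
  constructor <;> linarith

lemma sq_mem_slitPlane {s : ℂ} (hs : 0 < s.re) : s ^ 2 ∈ Complex.slitPlane := by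
  rw [Complex.mem_slitPlane_iff, pow_two, Complex.mul_re, Complex.mul_im]
  by_cases h : s.im = 0
  · left; rw [h]; nlinarith
  · right
    have := mul_ne_zero hs.ne' h
    intro h'
    apply this
    linarith

lemma slitSqrt_sq_of_re_pos {s : ℂ} (hs : 0 < s.re) : slitSqrt (s ^ 2) = s := by
  have hm := sq_mem_slitPlane hs
  have h1 := slitSqrt_sq (Complex.slitPlane_ne_zero hm)
  rcases sq_eq_sq_iff_eq_or_eq_neg.1 h1 with h | h
  · exact h
  · have := slitSqrt_re_pos hm
    rw [h, Complex.neg_re] at this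
    linarith

lemma cayley_re_pos {z : ℂ} (hz : z ∈ unitDisk) : 0 < ((1 + z) / (1 - z)).re := by
  have hne := one_sub_ne_zero hz
  have hn : 0 < Complex.normSq (1 - z) := Complex.normSq_pos.2 hne
  have hz' : Complex.normSq z < 1 := by
    rw [Complex.normSq_eq_norm_sq]
    have := mem_unitDisk.1 hz
    nlinarith [norm_nonneg z]
  rw [Complex.div_re, ← add_div]
  apply div_pos _ hn
  rw [Complex.normSq_apply] at hz'
  simp
  nlinarith

/-- The Cayley transform maps the disk into the right half-plane, where squaring is injective; this
identity is the source of the formula for `koebeInv`. -/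
lemma one_add_four_mul_koebe {z : ℂ} (hz : z ∈ unitDisk) :
    1 + 4 * koebe z = ((1 + z) / (1 - z)) ^ 2 := by
  have hne := one_sub_ne_zero hz
  rw [koebe]
  field_simp
  ring

lemma one_add_four_mul_koebe_mem {z : ℂ} (hz : z ∈ unitDisk) :
    1 + 4 * koebe z ∈ Complex.slitPlane := by
  rw [one_add_four_mul_koebe hz]
  exact sq_mem_slitPlane (cayley_re_pos hz)

lemma koebeInv_koebe {z : ℂ} (hz : z ∈ unitDisk) : koebeInv (koebe z) = z := by
  have hne := one_sub_ne_zero hz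
  rw [koebeInv, one_add_four_mul_koebe hz, slitSqrt_sq_of_re_pos (cayley_re_pos hz)]
  have h1 : (1 + z) / (1 - z) - 1 = 2 * z / (1 - z) := by field_simp; ring
  have h2 : (1 + z) / (1 - z) + 1 = 2 / (1 - z) := by field_simp; ring
  rw [h1, h2]
  field_simp

lemma add_one_ne_zero_of_re_pos {s : ℂ} (hs : 0 < s.re) : s + 1 ≠ 0 := by
  intro h
  have := congrArg Complex.re h
  simp at this
  linarith

lemma koebeInv_mem {w : ℂ} (hw : 1 + 4 * w ∈ Complex.slitPlane) : koebeInv w ∈ unitDisk := by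
  have hs := slitSqrt_re_pos hw
  have hne := add_one_ne_zero_of_re_pos hs
  rw [mem_unitDisk, koebeInv, norm_div, div_lt_one (norm_pos_iff.2 hne),
    ← sq_lt_sq₀ (norm_nonneg _) (norm_nonneg _), ← Complex.normSq_eq_norm_sq,
    ← Complex.normSq_eq_norm_sq, Complex.normSq_apply, Complex.normSq_apply]
  simp
  nlinarith

lemma koebe_koebeInv {w : ℂ} (hw : 1 + 4 * w ∈ Complex.slitPlane) : koebe (koebeInv w) = w := by
  have hne := add_one_ne_zero_of_re_pos (slitSqrt_re_pos hw)
  have hsq := slitSqrt_sq (Complex.slitPlane_ne_zero hw)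
  rw [koebe, koebeInv]
  set s := slitSqrt (1 + 4 * w)
  have h1 : 1 - (s - 1) / (s + 1) = 2 / (s + 1) := by field_simp; ring
  rw [h1]
  field_simp
  linear_combination hsq

lemma differentiableAt_koebeInv {w : ℂ} (hw : 1 + 4 * w ∈ Complex.slitPlane) :
    DifferentiableAt ℂ koebeInv w := by
  have hne := add_one_ne_zero_of_re_pos (slitSqrt_re_pos hw)
  have hs : DifferentiableAt ℂ (fun w => slitSqrt (1 + 4 * w)) w := by
    unfold slitSqrt
    have h1 : DifferentiableAt ℂ (fun w : ℂ => 1 + 4 * w) w := by fun_prop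
    exact ((h1.clog hw).div_const 2).cexp
  exact (hs.sub_const 1).div (hs.add_const 1) hne

/-! ### Horizontal shears of the Koebe function. -/

/-- The real part equals (|p|² - |q|²)/|p - q|². With p = H' and q = G' this turns sense
preservation into monotonicity of the shear. -/
lemma div_re_pos_of_norm_lt {p q : ℂ} (h : ‖q‖ < ‖p‖) : 0 < ((p + q) / (p - q)).re := by
  have hne : p - q ≠ 0 := by
    intro h'
    rw [sub_eq_zero.1 h'] at h
    exact lt_irrefl _ h
  have hn : Complex.normSq q < Complex.normSq p := by
    rw [Complex.normSq_eq_norm_sq, Complex.normSq_eq_norm_sq]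
    exact pow_lt_pow_left₀ h (norm_nonneg _) two_ne_zero
  rw [Complex.div_re, ← add_div]
  apply div_pos _ (Complex.normSq_pos.2 hne)
  rw [Complex.normSq_apply, Complex.normSq_apply] at hn
  simp
  nlinarith

/-- A sense-preserving harmonic mapping is a local homeomorphism, hence open. -/
lemma isOpen_image_harmonicMap {H G : ℂ → ℂ} {U : Set ℂ} (hU : IsOpen U)
    (hH : DifferentiableOn ℂ H U) (hG : DifferentiableOn ℂ G U)
    (hJ : ∀ z ∈ U, ‖deriv G z‖ < ‖deriv H z‖) : IsOpen (harmonicMap H G '' U) := by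
  rw [isOpen_iff_mem_nhds]
  rintro _ ⟨z, hz, rfl⟩
  have hH' := ((hH.analyticAt (hU.mem_nhds hz)).hasStrictDerivAt).complexToReal_fderiv
  have hG' := ((hG.analyticAt (hU.mem_nhds hz)).hasStrictDerivAt).complexToReal_fderiv
  have hf := hH'.add ((Complex.conjCLE : ℂ →L[ℝ] ℂ).hasStrictFDerivAt.comp z hG')
  set L : ℂ →L[ℝ] ℂ := deriv H z • (1 : ℂ →L[ℝ] ℂ) +
    (Complex.conjCLE : ℂ →L[ℝ] ℂ) ∘L (deriv G z • (1 : ℂ →L[ℝ] ℂ)) with hL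
  -- A kernel vector v satisfies |H'||v| = |G'||v|, so v = 0; in finite dimension the differential
  -- is then onto.
  have hinj : Function.Injective (L : ℂ →ₗ[ℝ] ℂ) := by
    rw [injective_iff_map_eq_zero]
    intro v hv
    have hv' : deriv H z * v + starRingEnd ℂ (deriv G z * v) = 0 := by
      simpa [hL] using hv
    have hn : ‖deriv H z‖ * ‖v‖ = ‖deriv G z‖ * ‖v‖ := by
      rw [← norm_mul, ← norm_mul, eq_neg_of_add_eq_zero_left hv', norm_neg, RCLike.norm_conj]
    by_contra hne
    exact (hJ z hz).ne' (mul_right_cancel₀ (norm_ne_zero_iff.2 hne) hn)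
  have hsurj := LinearMap.range_eq_top.2 (LinearMap.injective_iff_surjective.1 hinj)
  have hmap := hf.map_nhds_eq_of_surj hsurj
  change harmonicMap H G '' U ∈ nhds (harmonicMap H G z)
  have : harmonicMap H G '' U ∈ Filter.map (harmonicMap H G) (nhds z) :=
    Filter.image_mem_map (hU.mem_nhds hz)
  exact hmap ▸ this

lemma mem_lineInDirection_zero {w z : ℂ} : z ∈ lineInDirection 0 w ↔ z.im = w.im := by
  constructor
  · rintro ⟨t, rfl⟩
    simp
  · intro h
    refine ⟨z.re - w.re, ?_⟩
    apply Complex.ext <;> simp [h]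

/-- The real parts of the points of the Koebe domain at height `v`. -/
def koebeSlice (v : ℝ) : Set ℝ := {u : ℝ | 1 + 4 * ((u : ℂ) + v * Complex.I) ∈ Complex.slitPlane}

lemma mem_koebeSlice {u v : ℝ} : u ∈ koebeSlice v ↔ 0 < 1 + 4 * u ∨ v ≠ 0 := by
  simp [koebeSlice, Complex.mem_slitPlane_iff]

lemma convex_koebeSlice (v : ℝ) : Convex ℝ (koebeSlice v) := by
  by_cases hv : v = 0
  · have : koebeSlice v = Set.Ioi (-1 / 4) := by
      ext u
      rw [mem_koebeSlice]
      simp only [hv, ne_eq, not_true_eq_false, or_false, Set.mem_Ioi]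
      constructor <;> intro h <;> linarith
    rw [this]
    exact convex_Ioi _
  · have : koebeSlice v = Set.univ := by
      ext u
      simp [mem_koebeSlice, hv]
    rw [this]
    exact convex_univ

variable {H G : ℂ → ℂ} {C : ℝ}

lemma harmonicMap_im (z : ℂ) : (harmonicMap H G z).im = (H z - G z).im := by
  simp [harmonicMap, sub_eq_add_neg]

/-- The real part of a shear of the Koebe function increases along horizontal lines of the Koebe
domain. -/
lemma hasDerivAt_shear_slice (hC : 0 < C)
    (hH : DifferentiableOn ℂ H unitDisk) (hG : DifferentiableOn ℂ G unitDisk)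
    (hHG : ∀ z ∈ unitDisk, H z - G z = C * koebe z)
    (hJ : ∀ z ∈ unitDisk, ‖deriv G z‖ < ‖deriv H z‖) {u v : ℝ} (hu : u ∈ koebeSlice v) :
    ∃ d : ℝ, 0 < d ∧
      HasDerivAt (fun t : ℝ => (harmonicMap H G (koebeInv (t + v * Complex.I))).re) d u := by
  set w : ℂ := u + v * Complex.I with hw
  have hw' : 1 + 4 * w ∈ Complex.slitPlane := hu
  have hz := koebeInv_mem hw'
  set z := koebeInv w with hzdef
  have hd := (differentiableAt_koebeInv hw').hasDerivAt
  have hHz := ((hH z hz).differentiableAt (isOpen_unitDisk.mem_nhds hz)).hasDerivAt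
  have hGz := ((hG z hz).differentiableAt (isOpen_unitDisk.mem_nhds hz)).hasDerivAt
  -- Differentiate the identity (H - G) ∘ k⁻¹ = C w.
  have hchain : (deriv H z - deriv G z) * deriv koebeInv w = C := by
    have h1 : HasDerivAt (fun x => H (koebeInv x) - G (koebeInv x))
        ((deriv H z - deriv G z) * deriv koebeInv w) w := by
      have := (hHz.sub hGz).comp w hd
      exact this
    have hopen : IsOpen {x : ℂ | 1 + 4 * x ∈ Complex.slitPlane} :=
      Complex.isOpen_slitPlane.preimage (by fun_prop)
    have h2 : HasDerivAt (fun x : ℂ => (C : ℂ) * x) ((C : ℂ) * 1) w :=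
      (hasDerivAt_id w).const_mul _
    have heq : (fun x => H (koebeInv x) - G (koebeInv x)) =ᶠ[nhds w] fun x => (C : ℂ) * x := by
      filter_upwards [hopen.mem_nhds hw'] with x hx
      rw [hHG _ (koebeInv_mem hx), koebe_koebeInv hx]
    have := h1.unique (h2.congr_of_eventuallyEq heq)
    rw [this, mul_one]
  have hne : deriv H z - deriv G z ≠ 0 := by
    intro h
    rw [h, zero_mul] at hchain
    exact hC.ne (by exact_mod_cast hchain)
  have hderiv : HasDerivAt (fun x : ℂ => H (koebeInv (x + v * Complex.I)) +
      G (koebeInv (x + v * Complex.I))) ((deriv H z + deriv G z) * deriv koebeInv w) (u : ℂ) := by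
    have h1 : HasDerivAt (fun x => H (koebeInv x) + G (koebeInv x))
        ((deriv H z + deriv G z) * deriv koebeInv w) w := by
      have := (hHz.add hGz).comp w hd
      exact this
    exact HasDerivAt.comp_add_const (u : ℂ) (v * Complex.I) h1
  refine ⟨_, ?_, hderiv.real_of_complex.congr_of_eventuallyEq ?_⟩
  -- Eliminating (k⁻¹)' leaves C (H' + G')/(H' - G').
  · have : (deriv H z + deriv G z) * deriv koebeInv w =
        C * ((deriv H z + deriv G z) / (deriv H z - deriv G z)) := by
      rw [← hchain]
      field_simp
    rw [this, Complex.re_ofReal_mul]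
    exact mul_pos hC (div_re_pos_of_norm_lt (hJ z hz))
  · filter_upwards with t
    simp [harmonicMap]

lemma strictMonoOn_shear_slice (hC : 0 < C)
    (hH : DifferentiableOn ℂ H unitDisk) (hG : DifferentiableOn ℂ G unitDisk)
    (hHG : ∀ z ∈ unitDisk, H z - G z = C * koebe z)
    (hJ : ∀ z ∈ unitDisk, ‖deriv G z‖ < ‖deriv H z‖) (v : ℝ) :
    StrictMonoOn (fun t : ℝ => (harmonicMap H G (koebeInv (t + v * Complex.I))).re)
      (koebeSlice v) := by
  refine strictMonoOn_of_deriv_pos (convex_koebeSlice v) ?_ ?_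
  · intro u hu
    obtain ⟨d, -, hd⟩ := hasDerivAt_shear_slice hC hH hG hHG hJ hu
    exact hd.continuousAt.continuousWithinAt
  · intro u hu
    obtain ⟨d, hpos, hd⟩ := hasDerivAt_shear_slice hC hH hG hHG hJ (interior_subset hu)
    rwa [hd.deriv]

/-- Univalence of a sense-preserving horizontal shear of the Koebe function. -/
lemma injOn_shear (hC : 0 < C)
    (hH : DifferentiableOn ℂ H unitDisk) (hG : DifferentiableOn ℂ G unitDisk)
    (hHG : ∀ z ∈ unitDisk, H z - G z = C * koebe z)
    (hJ : ∀ z ∈ unitDisk, ‖deriv G z‖ < ‖deriv H z‖) : Set.InjOn (harmonicMap H G) unitDisk := by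
  intro z₁ h₁ z₂ h₂ heq
  have him : (koebe z₁).im = (koebe z₂).im := by
    have := congrArg Complex.im heq
    rw [harmonicMap_im, harmonicMap_im, hHG _ h₁, hHG _ h₂, Complex.im_ofReal_mul,
      Complex.im_ofReal_mul] at this
    exact mul_left_cancel₀ hC.ne' this
  have e₁ : ((koebe z₁).re : ℂ) + (koebe z₁).im * Complex.I = koebe z₁ := Complex.re_add_im _
  have e₂ : ((koebe z₂).re : ℂ) + (koebe z₁).im * Complex.I = koebe z₂ := by
    rw [him]; exact Complex.re_add_im _
  have hre := (strictMonoOn_shear_slice hC hH hG hHG hJ (koebe z₁).im).injOn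
    (x₁ := (koebe z₁).re) (x₂ := (koebe z₂).re)
    (by rw [koebeSlice, Set.mem_ofPred_eq, e₁]; exact one_add_four_mul_koebe_mem h₁)
    (by rw [koebeSlice, Set.mem_ofPred_eq, e₂]; exact one_add_four_mul_koebe_mem h₂)
    (by simp only [e₁, e₂, koebeInv_koebe h₁, koebeInv_koebe h₂, heq])
  rw [← koebeInv_koebe h₁, ← koebeInv_koebe h₂, Complex.ext hre him]

/-- A sense-preserving horizontal shear of the Koebe function is convex in the horizontal
direction. -/
lemma isCHD_shear (hC : 0 < C)
    (hH : DifferentiableOn ℂ H unitDisk) (hG : DifferentiableOn ℂ G unitDisk)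
    (hHG : ∀ z ∈ unitDisk, H z - G z = C * koebe z)
    (hJ : ∀ z ∈ unitDisk, ‖deriv G z‖ < ‖deriv H z‖) : IsCHD (harmonicMap H G) := by
  have hcont : ContinuousOn (harmonicMap H G) unitDisk :=
    hH.continuousOn.add (Complex.continuous_conj.comp_continuousOn hG.continuousOn)
  refine ⟨isOpen_image_harmonicMap isOpen_unitDisk hH hG hJ, ?_, fun w => ?_⟩
  · exact ((Metric.isConnected_ball one_pos).image _ hcont)
  -- The imaginary part of the map is C Im k, so the line at height `w.im` pulls back to the Koebe
  -- slice at height `w.im / C`.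
  · set v := w.im / C with hv
    have hset : harmonicMap H G '' unitDisk ∩ lineInDirection 0 w =
        (fun t : ℝ => harmonicMap H G (koebeInv (t + v * Complex.I))) '' koebeSlice v := by
      ext x
      rw [Set.mem_inter_iff, mem_lineInDirection_zero]
      constructor
      · rintro ⟨⟨z, hz, rfl⟩, him⟩
        rw [harmonicMap_im, hHG z hz, Complex.im_ofReal_mul] at him
        have hv' : (koebe z).im = v := by
          rw [hv, ← him]
          field_simp
        have e : ((koebe z).re : ℂ) + v * Complex.I = koebe z := by
          rw [← hv']; exact Complex.re_add_im _
        refine ⟨(koebe z).re, ?_, ?_⟩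
        · rw [koebeSlice, Set.mem_ofPred_eq, e]
          exact one_add_four_mul_koebe_mem hz
        · simp only [e, koebeInv_koebe hz]
      · rintro ⟨u, hu, rfl⟩
        have hz := koebeInv_mem (w := (u : ℂ) + v * Complex.I) hu
        refine ⟨⟨_, hz, rfl⟩, ?_⟩
        rw [harmonicMap_im, hHG _ hz, koebe_koebeInv hu, Complex.im_ofReal_mul, hv]
        simp
        field_simp
    rw [hset]
    refine (convex_koebeSlice v).isPreconnected.image _ ?_
    intro u hu
    have hz := koebeInv_mem (w := (u : ℂ) + v * Complex.I) hu
    refine ContinuousAt.continuousWithinAt ?_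
    refine ContinuousAt.comp (f := fun t : ℝ => koebeInv (t + v * Complex.I))
      (hcont.continuousAt (isOpen_unitDisk.mem_nhds hz)) ?_
    exact ContinuousAt.comp (f := fun t : ℝ => (t : ℂ) + v * Complex.I)
      (differentiableAt_koebeInv hu).continuousAt (by fun_prop)

/-! ### Taylor coefficients and Hadamard products. -/

lemma taylorCoeff_eq_of_hasSum {F : ℂ → ℂ} {c : ℕ → ℂ}
    (h : ∀ z ∈ unitDisk, HasSum (fun n => c n * z ^ n) (F z)) (n : ℕ) : taylorCoeff F n = c n := by
  have hp : HasFPowerSeriesAt F (FormalMultilinearSeries.ofScalars ℂ c) 0 := by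
    rw [hasFPowerSeriesAt_iff]
    filter_upwards [isOpen_unitDisk.mem_nhds (x := (0 : ℂ)) (by simp [mem_unitDisk])] with z hz
    simpa [FormalMultilinearSeries.coeff_ofScalars, mul_comm] using h z hz
  have := hp.analyticAt.hasFPowerSeriesAt.eq_formalMultilinearSeries hp
  have := congrArg (fun p => p.coeff n) this
  simpa [FormalMultilinearSeries.coeff_ofScalars, taylorCoeff] using this

lemma hasSum_taylorCoeff {F : ℂ → ℂ} (hF : DifferentiableOn ℂ F unitDisk) {z : ℂ}
    (hz : z ∈ unitDisk) : HasSum (fun n => taylorCoeff F n * z ^ n) (F z) := by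
  convert! Complex.hasSum_taylorSeries_on_ball hF hz using 1
  funext n
  simp only [taylorCoeff, sub_zero, smul_eq_mul]
  ring

lemma natCast_succ_mul_taylorCoeff (F : ℂ → ℂ) (n : ℕ) :
    ((n + 1 : ℕ) : ℂ) * taylorCoeff F (n + 1) = taylorCoeff (deriv F) n := by
  have h1 : ((n.factorial : ℕ) : ℂ) ≠ 0 := by exact_mod_cast n.factorial_ne_zero
  have h2 : ((n + 1 : ℕ) : ℂ) ≠ 0 := by exact_mod_cast n.succ_ne_zero
  rw [taylorCoeff, taylorCoeff, iteratedDeriv_succ', Nat.factorial_succ, Nat.cast_mul]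
  field_simp

lemma hasSum_natCast_mul_taylorCoeff {F : ℂ → ℂ} (hF : DifferentiableOn ℂ F unitDisk) {z : ℂ}
    (hz : z ∈ unitDisk) :
    HasSum (fun n : ℕ => n * taylorCoeff F n * z ^ n) (z * deriv F z) := by
  rw [← hasSum_nat_add_iff' 1]
  convert! (hasSum_taylorCoeff (hF.deriv isOpen_unitDisk) hz).mul_left z using 1
  · funext n
    rw [natCast_succ_mul_taylorCoeff]
    ring
  · simp

/-- Convolution with the half-sum of `c z / (1 - z)²` and `z / (1 - z)` sends `f` to the half-sum of
`f` and `c z (deriv f z)`. -/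
lemma hadamard_eq {F f : ℂ → ℂ} {c : ℂ}
    (hF : ∀ z ∈ unitDisk, F z = (c * koebe z + z / (1 - z)) / 2)
    (hf : DifferentiableOn ℂ f unitDisk) (hf0 : f 0 = 0) {z : ℂ} (hz : z ∈ unitDisk) :
    hadamard F f z = (f z + c * (z * deriv f z)) / 2 := by
  -- The `if` removes the constant term of 1/(1 - z), since z/(1 - z) = 1/(1 - z) - 1.
  have hcoeff : ∀ n, taylorCoeff F n = (c * n + 1 - if n = 0 then 1 else 0) / 2 := by
    refine taylorCoeff_eq_of_hasSum fun w hw => ?_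
    have hw' := mem_unitDisk.1 hw
    have hne := one_sub_ne_zero hw
    have h1 := (hasSum_coe_mul_geometric_of_norm_lt_one hw').mul_left c
    have h2 := hasSum_geometric_of_norm_lt_one hw'
    have h3 := hasSum_ite_eq (0 : ℕ) (1 : ℂ)
    convert! ((h1.add h2).sub h3).div_const 2 using 1
    · funext n
      split_ifs with hn
      · simp [hn]
      · ring
    · rw [hF w hw, koebe]
      field_simp
      ring
  have hsum := ((hasSum_taylorCoeff hf hz).add
    ((hasSum_natCast_mul_taylorCoeff hf hz).mul_left c)).div_const 2
  rw [hadamard, ← hsum.tsum_eq]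
  congr 1
  funext n
  rw [hcoeff]
  split_ifs with hn
  · simp [hn, taylorCoeff, hf0]
  · ring

lemma hA_eq {a : ℝ} (ha : (1 + a : ℂ) ≠ 0) {z : ℂ} (hz : z ∈ unitDisk) :
    hA a z = ((1 - a) / (1 + a) * koebe z + z / (1 - z)) / 2 := by
  have hne := one_sub_ne_zero hz
  rw [hA, koebe]
  field_simp
  ring

lemma gA_eq {a : ℝ} (ha : (1 + a : ℂ) ≠ 0) {z : ℂ} (hz : z ∈ unitDisk) :
    gA a z = (-((1 - a) / (1 + a)) * koebe z + z / (1 - z)) / 2 := by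
  have hne := one_sub_ne_zero hz
  rw [gA, koebe]
  field_simp
  ring

lemma one_add_ofReal_ne_zero {a : ℝ} (ha : |a| < 1) : (1 + a : ℂ) ≠ 0 := by
  have := (abs_lt.1 ha).1
  exact_mod_cast (by linarith : (1 + a : ℝ) ≠ 0)

/-! ### The Jacobian estimate. -/

/-- The numerator of the derivative of the analytic part of `f_a * f_b` dominates that of the
co-analytic part. -/
lemma norm_numerator_lt {a b : ℝ} (ha : |a| < 1) (hb : |b| < 1)
    (hab : -((1 + 3 * a) / (3 + a)) ≤ b) {z : ℂ} (hz : z ∈ unitDisk) :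
    ‖2 * a * b + (1 - 3 * a - 3 * b + a * b) * z + 2 * z ^ 2‖ <
      ‖2 + (1 - 3 * a - 3 * b + a * b) * z + 2 * a * b * z ^ 2‖ := by
  obtain ⟨ha1, ha2⟩ := abs_lt.1 ha
  obtain ⟨hb1, hb2⟩ := abs_lt.1 hb
  have hz' := mem_unitDisk.1 hz
  have hr : Complex.normSq z < 1 := by
    rw [Complex.normSq_eq_norm_sq]
    nlinarith [norm_nonneg z]
  rw [← sq_lt_sq₀ (norm_nonneg _) (norm_nonneg _), ← Complex.normSq_eq_norm_sq,
    ← Complex.normSq_eq_norm_sq, ← sub_pos]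
  set k : ℝ := 1 - 3 * a - 3 * b + a * b with hk
  have hid : Complex.normSq (2 + (1 - 3 * a - 3 * b + a * b) * z + 2 * a * b * z ^ 2) -
      Complex.normSq (2 * a * b + (1 - 3 * a - 3 * b + a * b) * z + 2 * z ^ 2) =
      (2 - 2 * (a * b)) * (1 - Complex.normSq z) *
        ((2 + 2 * (a * b)) * (1 + Complex.normSq z) + 2 * k * z.re) := by
    simp only [Complex.normSq_apply, pow_two, Complex.add_re, Complex.add_im, Complex.mul_re,
      Complex.mul_im, Complex.sub_re, Complex.sub_im, Complex.ofReal_re, Complex.ofReal_im,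
      Complex.re_ofNat, Complex.im_ofNat, Complex.one_re, Complex.one_im, hk]
    ring
  have habs : |a * b| < 1 := by
    rw [abs_mul]
    nlinarith [abs_nonneg a, abs_nonneg b]
  obtain ⟨hp, hq⟩ := abs_lt.1 habs
  -- Equivalent to 1 + 3a + 3b + ab ≥ 0, which is the hypothesis on b.
  have hk1 : k ≤ 2 + 2 * (a * b) := by
    rw [← neg_div, div_le_iff₀ (by linarith)] at hab
    rw [hk]
    linarith
  -- Here 2 + 2ab + k = 3(1 - a)(1 - b).
  have hk2 : -k ≤ 2 + 2 * (a * b) := by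
    rw [hk]
    nlinarith
  have hx : z.re ^ 2 ≤ Complex.normSq z := by
    rw [Complex.normSq_apply]
    nlinarith [sq_nonneg z.im]
  have hx1 : |z.re| < 1 := lt_of_le_of_lt (Complex.abs_re_le_norm z) hz'
  rw [hid]
  refine mul_pos (mul_pos (by linarith) (by linarith)) ?_
  have hkx : -((2 + 2 * (a * b)) * |z.re|) ≤ k * z.re := by
    have h1 : |k * z.re| ≤ (2 + 2 * (a * b)) * |z.re| := by
      rw [abs_mul]
      exact mul_le_mul_of_nonneg_right (abs_le.2 ⟨by linarith, hk1⟩) (abs_nonneg _)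
    linarith [neg_abs_le (k * z.re)]
  -- As |z|² ≥ (Re z)², the expression is at least (1 - |Re z|)².
  have hsq : 0 < 1 + Complex.normSq z - 2 * |z.re| := by
    have : 0 < (1 - |z.re|) ^ 2 := pow_pos (by linarith) 2
    nlinarith [sq_abs z.re]
  nlinarith [mul_pos (by linarith : 0 < 2 + 2 * (a * b)) hsq]

/-! ### The half-plane mapping f_b. -/

section HalfPlane

variable {b : ℝ} {h g : ℂ → ℂ}

lemma one_sub_mul_ne_zero (hb : |b| < 1) {z : ℂ} (hz : z ∈ unitDisk) : 1 - (b : ℂ) * z ≠ 0 := by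
  apply one_sub_ne_zero
  have := mem_unitDisk.1 hz
  rw [mem_unitDisk, norm_mul, Complex.norm_real, Real.norm_eq_abs]
  nlinarith [abs_nonneg b, norm_nonneg z]

/-- Solve the linear system h' + g' = 1/(1 - z)², g' = ω h', using 1 + ω = (1 + b)(1 - z)/(1 - bz).
-/
lemma deriv_halfPlane (hb : |b| < 1)
    (hh : DifferentiableOn ℂ h unitDisk) (hg : DifferentiableOn ℂ g unitDisk)
    (h_sum : ∀ z ∈ unitDisk, h z + g z = z / (1 - z))
    (h_dil : HasDilatation h g (fun z : ℂ => ((b : ℂ) - z) / (1 - (b : ℂ) * z)))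
    {z : ℂ} (hz : z ∈ unitDisk) :
    deriv h z = (1 - b * z) / ((1 + b) * (1 - z) ^ 3) ∧
      deriv g z = (b - z) / ((1 + b) * (1 - z) ^ 3) := by
  have hne := one_sub_ne_zero hz
  have hne' := one_sub_mul_ne_zero hb hz
  have hb' := one_add_ofReal_ne_zero hb
  have hmem := isOpen_unitDisk.mem_nhds hz
  obtain ⟨h0, hω⟩ := h_dil z hz
  have hhz := ((hh z hz).differentiableAt hmem).hasDerivAt
  have hgz := ((hg z hz).differentiableAt hmem).hasDerivAt
  have hs : deriv h z + deriv g z = 1 / (1 - z) ^ 2 := by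
    have h1 := (hasDerivAt_id z).div ((hasDerivAt_id z).const_sub 1) hne
    have h2 := h1.congr_of_eventuallyEq (f₁ := fun w => h w + g w)
      (by filter_upwards [hmem] with w hw using h_sum w hw)
    rw [(hhz.add hgz).unique h2]
    simp
  have hg' : deriv g z = (b - z) / (1 - b * z) * deriv h z := by
    exact ((div_eq_iff h0).1 hω)
  have hh' : deriv h z = (1 - b * z) / ((1 + b) * (1 - z) ^ 3) := by
    rw [hg'] at hs
    field_simp at hs ⊢
    apply mul_right_cancel₀ hne'
    linear_combination (1 - b * z) * hs
  refine ⟨hh', ?_⟩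
  rw [hg', hh']
  field_simp

/-- Both sides vanish at 0 and have derivative (1 - b)(1 + z)/((1 + b)(1 - z)³). -/
lemma halfPlane_sub (hb : |b| < 1)
    (hh : DifferentiableOn ℂ h unitDisk) (hg : DifferentiableOn ℂ g unitDisk)
    (h_zero : h 0 = 0) (h_sum : ∀ z ∈ unitDisk, h z + g z = z / (1 - z))
    (h_dil : HasDilatation h g (fun z : ℂ => ((b : ℂ) - z) / (1 - (b : ℂ) * z)))
    {z : ℂ} (hz : z ∈ unitDisk) : h z - g z = (1 - b) / (1 + b) * koebe z := by
  have hb' := one_add_ofReal_ne_zero hb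
  have h0 : (0 : ℂ) ∈ unitDisk := by simp [mem_unitDisk]
  have hk : ∀ w ∈ unitDisk, HasDerivAt (fun x => (1 - b) / (1 + b) * koebe x)
      ((1 - b) / (1 + b) * ((1 + w) / (1 - w) ^ 3)) w := by
    intro w hw
    have hne := one_sub_ne_zero hw
    have := (hasDerivAt_id w).div (((hasDerivAt_id w).const_sub 1).pow 2) (pow_ne_zero 2 hne)
    refine HasDerivAt.const_mul _ (this.congr_deriv ?_)
    simp
    field_simp
    ring
  refine isOpen_unitDisk.eqOn_of_deriv_eq (f := fun z => h z - g z)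
    (Metric.isConnected_ball one_pos).isPreconnected (hh.sub hg)
    (fun w hw => (hk w hw).differentiableAt.differentiableWithinAt) (fun w hw => ?_) h0 ?_ hz
  · have hne := one_sub_ne_zero hw
    have hmem := isOpen_unitDisk.mem_nhds hw
    have hd := ((hh w hw).differentiableAt hmem).hasDerivAt.sub
      ((hg w hw).differentiableAt hmem).hasDerivAt
    obtain ⟨e₁, e₂⟩ := deriv_halfPlane hb hh hg h_sum h_dil hw
    rw [(hk w hw).deriv]
    refine hd.deriv.trans ?_
    rw [e₁, e₂]
    field_simp
    ring
  · have := h_sum 0 h0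
    simp [h_zero] at this
    simp [h_zero, this, koebe]

end HalfPlane

/-- The derivative of the half-sum of `f` and `c z (deriv f z)` when `deriv f` is
`(p - q z) / (d (1 - z)³)`. -/
lemma hasDerivAt_half_add {f : ℂ → ℂ} {c d p q : ℂ} (hd : d ≠ 0)
    (hf : ∀ z ∈ unitDisk, DifferentiableAt ℂ f z)
    (hf' : ∀ z ∈ unitDisk, deriv f z = (p - q * z) / (d * (1 - z) ^ 3))
    {z : ℂ} (hz : z ∈ unitDisk) :
    HasDerivAt (fun w => (f w + c * (w * deriv f w)) / 2)
      (((1 + c) * (p - q * z) * (1 - z) + c * z * (3 * p - q - 2 * q * z)) /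
        (2 * d * (1 - z) ^ 4)) z := by
  have hne := one_sub_ne_zero hz
  have h1 : HasDerivAt (fun w : ℂ => (p - q * w) / (d * (1 - w) ^ 3))
      ((3 * p - q - 2 * q * z) / (d * (1 - z) ^ 4)) z := by
    have := (((hasDerivAt_id z).const_mul q).const_sub p).div
      ((((hasDerivAt_id z).const_sub 1).pow 3).const_mul d) (mul_ne_zero hd (pow_ne_zero 3 hne))
    refine this.congr_deriv ?_
    simp
    field_simp
    ring
  have h2 := h1.congr_of_eventuallyEq (f₁ := deriv f)
    (by filter_upwards [isOpen_unitDisk.mem_nhds hz] with w hw using hf' w hw)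
  have h3 := ((hf z hz).hasDerivAt.add
    (((hasDerivAt_id z).mul h2).const_mul c)).div_const 2
  refine h3.congr_deriv ?_
  rw [hf' z hz]
  simp
  field_simp
  ring

end HarmonicConv

/-! ### The convolution as a shear of the Koebe function. -/

theorem theorem2p3 (a b : ℝ) (ha : |a| < 1) (hb : |b| < 1)
    (hab : -((1 + 3 * a) / (3 + a)) ≤ b)
    (h g : ℂ → ℂ)
    (hh : DifferentiableOn ℂ h HarmonicConv.unitDisk)
    (hg : DifferentiableOn ℂ g HarmonicConv.unitDisk)
    (h_zero : h 0 = 0)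
    (h_sum : ∀ z ∈ HarmonicConv.unitDisk, h z + g z = z / (1 - z))
    (h_dil : HarmonicConv.HasDilatation h g
      (fun z : ℂ => ((b : ℂ) - z) / (1 - (b : ℂ) * z))) :
    HarmonicConv.InSH (fun z : ℂ => (((1 + a) * (1 + b) : ℝ) : ℂ) *
        HarmonicConv.convolution (HarmonicConv.hA a) (HarmonicConv.gA a) h g z) ∧
      HarmonicConv.IsCHD
        (HarmonicConv.convolution (HarmonicConv.hA a) (HarmonicConv.gA a) h g) := by
  open HarmonicConv in
  have ha' := one_add_ofReal_ne_zero ha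
  have hb' := one_add_ofReal_ne_zero hb
  obtain ⟨ha1, ha2⟩ := abs_lt.1 ha
  obtain ⟨hb1, hb2⟩ := abs_lt.1 hb
  have h0 : (0 : ℂ) ∈ unitDisk := by simp [mem_unitDisk]
  have hg_zero : g 0 = 0 := by
    have := h_sum 0 h0
    simpa [h_zero] using this
  set H := hadamard (hA a) h with hH
  set G := hadamard (gA a) g with hG
  have hHeq : ∀ z ∈ unitDisk, H z = (h z + (1 - a) / (1 + a) * (z * deriv h z)) / 2 :=
    fun z hz => hadamard_eq (fun w hw => hA_eq ha' hw) hh h_zero hz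
  have hGeq : ∀ z ∈ unitDisk, G z = (g z + -((1 - a) / (1 + a)) * (z * deriv g z)) / 2 :=
    fun z hz => hadamard_eq (fun w hw => gA_eq ha' hw) hg hg_zero hz
  have hder := fun z (hz : z ∈ unitDisk) => deriv_halfPlane hb hh hg h_sum h_dil hz
  have hHd : ∀ z ∈ unitDisk, HasDerivAt H
      ((2 + (1 - 3 * a - 3 * b + a * b) * z + 2 * a * b * z ^ 2) /
        (2 * ((1 + a) * (1 + b)) * (1 - z) ^ 4)) z := by
    intro z hz
    have hne := one_sub_ne_zero hz
    have h1 := hasDerivAt_half_add (c := (1 - a) / (1 + a)) (p := 1) (q := b) hb'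
      (fun w hw => (hh w hw).differentiableAt (isOpen_unitDisk.mem_nhds hw))
      (fun w hw => (hder w hw).1) hz
    refine (h1.congr_of_eventuallyEq ?_).congr_deriv ?_
    · filter_upwards [isOpen_unitDisk.mem_nhds hz] with w hw using hHeq w hw
    · field_simp
      ring
  have hGd : ∀ z ∈ unitDisk, HasDerivAt G
      ((2 * a * b + (1 - 3 * a - 3 * b + a * b) * z + 2 * z ^ 2) /
        (2 * ((1 + a) * (1 + b)) * (1 - z) ^ 4)) z := by
    intro z hz
    have hne := one_sub_ne_zero hz
    have h1 := hasDerivAt_half_add (c := -((1 - a) / (1 + a))) (p := b) (q := 1) hb'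
      (fun w hw => (hg w hw).differentiableAt (isOpen_unitDisk.mem_nhds hw))
      (fun w hw => by rw [(hder w hw).2, one_mul]) hz
    refine (h1.congr_of_eventuallyEq ?_).congr_deriv ?_
    · filter_upwards [isOpen_unitDisk.mem_nhds hz] with w hw using hGeq w hw
    · field_simp
      ring
  have hJ : ∀ z ∈ unitDisk, ‖deriv G z‖ < ‖deriv H z‖ := by
    intro z hz
    have hne := one_sub_ne_zero hz
    rw [(hHd z hz).deriv, (hGd z hz).deriv, norm_div, norm_div]
    refine div_lt_div_of_pos_right (norm_numerator_lt ha hb hab hz) (norm_pos_iff.2 ?_)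
    exact mul_ne_zero (mul_ne_zero two_ne_zero (mul_ne_zero ha' hb')) (pow_ne_zero 4 hne)
  have hHD : DifferentiableOn ℂ H unitDisk :=
    fun z hz => (hHd z hz).differentiableAt.differentiableWithinAt
  have hGD : DifferentiableOn ℂ G unitDisk :=
    fun z hz => (hGd z hz).differentiableAt.differentiableWithinAt
  have hC : 0 < (1 - a * b) / ((1 + a) * (1 + b)) := by
    have : 0 < 1 - a * b := by
      have h1 : |a * b| < 1 := by
        rw [abs_mul]
        nlinarith [abs_nonneg a, abs_nonneg b]
      linarith [le_abs_self (a * b)]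
    exact div_pos this (mul_pos (by linarith) (by linarith))
  -- The constant is the mean of (1-a)/(1+a) and (1-b)/(1+b).
  have hHG : ∀ z ∈ unitDisk, H z - G z =
      ((1 - a * b) / ((1 + a) * (1 + b)) : ℝ) * koebe z := by
    intro z hz
    have hne := one_sub_ne_zero hz
    have e₁ := halfPlane_sub hb hh hg h_zero h_sum h_dil hz
    obtain ⟨e₂, e₃⟩ := hder z hz
    have e₄ : z * deriv h z + z * deriv g z = koebe z := by
      rw [e₂, e₃, koebe]
      field_simp
      ring
    have e₅ : H z - G z =
        ((h z - g z) + (1 - a) / (1 + a) * (z * deriv h z + z * deriv g z)) / 2 := by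
      rw [hHeq z hz, hGeq z hz]
      ring
    rw [e₅, e₁, e₄]
    push_cast
    field_simp
    ring
  have hκ : (((1 + a) * (1 + b) : ℝ) : ℂ) ≠ 0 := by
    push_cast
    exact mul_ne_zero ha' hb'
  refine ⟨⟨fun z => (((1 + a) * (1 + b) : ℝ) : ℂ) * H z,
    fun z => (((1 + a) * (1 + b) : ℝ) : ℂ) * G z, hHD.const_mul _, hGD.const_mul _, ?_, ?_, ?_, ?_,
    ?_, ?_⟩, isCHD_shear hC hHD hGD hHG hJ⟩
  · simp [hHeq 0 h0, h_zero]
  · simp [hGeq 0 h0, hg_zero]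
  -- H'(0) = 1/((1 + a)(1 + b)), which explains the normalizing factor.
  · rw [((hHd 0 h0).const_mul _).deriv]
    push_cast
    field_simp
    simp
  · intro z _
    simp only [convolution, harmonicMap, map_mul, Complex.conj_ofReal, hH, hG]
    ring
  · intro z hz
    rw [((hHd z hz).differentiableAt.hasDerivAt.const_mul _).deriv,
      ((hGd z hz).differentiableAt.hasDerivAt.const_mul _).deriv, norm_mul, norm_mul, sub_pos]
    exact pow_lt_pow_left₀ (mul_lt_mul_of_pos_left (hJ z hz) (norm_pos_iff.2 hκ))
      (by positivity) two_ne_zero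
  · intro z hz w hw hzw
    exact injOn_shear hC hHD hGD hHG hJ hz hw (mul_left_cancel₀ hκ hzw)
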